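/- Let $\varepsilon>0$, $n\ge 1$, $h=1/n$, $x_j=jh$ for $0\le j\le n$, and $f\in L^2(0,1)$. Write $(\cdot,\cdot)$ and $\|\cdot\|$ for the inner product and norm of $L^2(0,1)$, $\overline v=\int_0^1 v(x)\,dx$, and let $V=Q=H^1_0(0,1)$, with functions identified with their continuous representatives. For $u,v\in H^1_0(0,1)$ put $a_0(u,v)=(u',v')$, $|v|=a_0(v,v)^{1/2}$ and $b(v,u)=\varepsilon\,a_0(u,v)+(u',v)$. Let $\mathcal M_h\subset Q$ be the space of functions in $H^1_0(0,1)$ that are polynomials of degree at most $1$ on each $[x_{j-1},x_j]$, and $V_h\subset V$ the space of functions in $H^1_0(0,1)$ that are polynomials of degree at most $2$ on each $[x_{j-1},x_j]$. Define the continuous and discrete optimal trial norms by $$\|u\|_*=\sup_{0\ne v\in V}\frac{b(v,u)}{|v|}\quad(u\in Q),\qquad \|u_h\|_{*,h}=\sup_{0\ne v_h\in V_h}\frac{b(v_h,u_h)}{|v_h|}\quad(u_h\in\mathcal M_h).$$ (i) These suprema are finite. For every $u\in Q$, $$\|u\|_*^2=\varepsilon^2|u|^2+\|u-\overline u\|^2=\varepsilon^2|u|^2+\|u\|^2-\overline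 u^{\,2},$$ and $\|u_h\|_{*,h}=\|u_h\|_*$ for every $u_h\in\mathcal M_h$. (ii) Let $u\in Q$ be the solution of the variational formulation of $-\varepsilon u''+u'=f$ on $(0,1)$, $u(0)=u(1)=0$, i.e. $b(v,u)=(f,v)$ for all $v\in V$. Let $u_h$ be the $P^1$–$P^2$ saddle point least squares (SPLS) solution, i.e. the second component of a pair $(w_h,u_h)\in V_h\times\mathcal M_h$ with $$a_0(w_h,v_h)+b(v_h,u_h)=(f,v_h)\ \ \forall v_h\in V_h,\qquad b(w_h,q_h)=0\ \ \forall q_h\in\mathcal M_h.$$ Then $$\|u-u_h\|_*\le\inf_{p_h\in\mathcal M_h}\|u-p_h\|_*\le\|u-u_I\|_*,$$ where $u_I\in\mathcal M_h$ is the continuous piecewise linear interpolant of $u$ at the nodes $x_0,\dots,x_n$. -/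

import Mathlib

open MeasureTheory Set
open scoped ContDiff

namespace SPLS

noncomputable section

/-! Functions on the interval `[0, 1]` are represented by functions `ℝ → ℝ`; nothing below
depends on their values outside `[0, 1]`. -/

/-- The `L²(0,1)` inner product `(u, v) = ∫₀¹ u v`. -/
def ip (u v : ℝ → ℝ) : ℝ := ∫ x in (0 : ℝ)..1, u x * v x

/-- The `L²(0,1)` norm `‖u‖`. -/
def l2Norm (u : ℝ → ℝ) : ℝ := Real.sqrt (ip u u)

/-- The average `∫₀¹ u`. -/
def avg (u : ℝ → ℝ) : ℝ := ∫ x in (0 : ℝ)..1, u x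

/-- `u ∈ L²(0,1)`. -/
def MemL2 (u : ℝ → ℝ) : Prop := MemLp u 2 (volume.restrict (Ioo (0 : ℝ) 1))

/-- `g` is a weak derivative of `u` on `(0,1)`: `(u, φ') = -(g, φ)` for all test functions
`φ ∈ C_c^∞(0,1)`. -/
def IsWeakDeriv (u g : ℝ → ℝ) : Prop :=
  ∀ φ : ℝ → ℝ, ContDiff ℝ ∞ φ → HasCompactSupport φ → tsupport φ ⊆ Ioo (0 : ℝ) 1 →
    ip u (deriv φ) = -ip g φ

/-- The Sobolev space `H¹₀(0,1)`; its elements are identified with their continuous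
representatives, which vanish at `0` and `1`. -/
def H10 : Set (ℝ → ℝ) :=
  {u | ContinuousOn u (Icc 0 1) ∧ u 0 = 0 ∧ u 1 = 0 ∧ ∃ g, MemL2 g ∧ IsWeakDeriv u g}

open Classical in
/-- The weak derivative `u' ∈ L²(0,1)` (determined up to a null set), whenever there is one. -/
def wderiv (u : ℝ → ℝ) : ℝ → ℝ :=
  if h : ∃ g, MemL2 g ∧ IsWeakDeriv u g then h.choose else 0

/-- `a₀(u, v) = (u', v')`. -/
def a0 (u v : ℝ → ℝ) : ℝ := ip (wderiv u) (wderiv v)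

/-- The seminorm `|u| = ‖u'‖ = a₀(u, u)^{1/2}`. -/
def h1Semi (u : ℝ → ℝ) : ℝ := l2Norm (wderiv u)

/-- The bilinear form `b(v, u) = ε a₀(u, v) + (u', v)` of the convection-diffusion problem. -/
def b (ε : ℝ) (v u : ℝ → ℝ) : ℝ := ε * a0 u v + ip (wderiv u) v

/-- Variational formulation of `-ε u'' + u' = f` on `(0,1)`, `u(0) = u(1) = 0`. -/
def IsWeakSolution (ε : ℝ) (f u : ℝ → ℝ) : Prop :=
  u ∈ H10 ∧ ∀ v ∈ H10, b ε v u = ip f v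

/-- The space `C⁰-P^k`, with zero boundary values, on the uniform nodes `x_j = j / n`: the
functions of `H¹₀(0,1)` that agree on each `[x_j, x_{j+1}]` with a polynomial of degree at
most `k`. -/
def feSpace (k n : ℕ) : Set (ℝ → ℝ) :=
  {v | v ∈ H10 ∧ ∀ j < n, ∃ p : Polynomial ℝ, p.natDegree ≤ k ∧
    ∀ x ∈ Icc ((j : ℝ) / n) (((j : ℝ) + 1) / n), v x = p.eval x}

/-- The trial space `M_h = C⁰-P¹`. -/
def trialSpace (n : ℕ) : Set (ℝ → ℝ) := feSpace 1 n

/-- The test space `V_h = C⁰-P²`. -/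
def testSpace (n : ℕ) : Set (ℝ → ℝ) := feSpace 2 n

/-- `(w, u) ∈ V_h × M_h` solves the `P¹-P²` saddle point least squares system. -/
def IsSPLSSolution (ε : ℝ) (n : ℕ) (f w u : ℝ → ℝ) : Prop :=
  w ∈ testSpace n ∧ u ∈ trialSpace n ∧
    (∀ v ∈ testSpace n, a0 w v + b ε v u = ip f v) ∧
    (∀ q ∈ trialSpace n, b ε w q = 0)

/-- The quotients `b(v, u) / |v|`, for `v` in the test space `V` with `|v| ≠ 0`. -/
def quotients (ε : ℝ) (V : Set (ℝ → ℝ)) (u : ℝ → ℝ) : Set ℝ :=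
  {r | ∃ v ∈ V, h1Semi v ≠ 0 ∧ r = b ε v u / h1Semi v}

/-- The continuous optimal trial norm `‖u‖_* = sup_{v ∈ V} b(v, u) / |v|`, `V = H¹₀(0,1)`. -/
def starNorm (ε : ℝ) (u : ℝ → ℝ) : ℝ := sSup (quotients ε H10 u)

/-- The discrete optimal trial norm `‖u‖_{*,h} = sup_{v ∈ V_h} b(v, u) / |v|`. -/
def starNormDiscrete (ε : ℝ) (n : ℕ) (u : ℝ → ℝ) : ℝ := sSup (quotients ε (testSpace n) u)

/-- The nodal function `φ_j` of the node `x_j = j / n`: piecewise linear, with value `1` at `x_j`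
and `0` at all other nodes. -/
def hat (n j : ℕ) (x : ℝ) : ℝ := max 0 (1 - |n * x - j|)

/-- The piecewise linear nodal interpolant `u_I = ∑_j u(x_j) φ_j`. -/
def nodalInterp (n : ℕ) (u : ℝ → ℝ) (x : ℝ) : ℝ :=
  ∑ j ∈ Finset.range (n + 1), u ((j : ℝ) / n) * hat n j x

end

end SPLS

/-! For `v` in H¹₀, integration by parts gives b(v,u) = (F_u, v') with F_u = εu' - (u - ū); the mean
ū may be inserted because v' has mean zero (`b_eq_ip_rieszDeriv`). F_u itself has mean zero, so its
primitive lies in H¹₀ and is the Riesz representative of b(·,u). By Cauchy-Schwarz the supremum is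
‖F_u‖ (`isLUB_quotients`), and its square splits because (u', u - ū) = 0.

If u is piecewise linear, so is F_u, with jumps at the nodes; its primitive is continuous and
piecewise quadratic, hence in V_h, and the discrete supremum is the same number
(`primitive_rieszDeriv_mem_testSpace`).

For the error, these representatives are used as test functions: the term in w_h becomes b(w_h,q) =
0, so F_{u-u_h} is orthogonal to every F_q with q in M_h, and Pythagoras gives best approximation.
The bridge from weak derivatives to calculus is `mem_H10_iff`. -/

namespace SPLS

/-! ### The L² inner product on (0,1). -/

/-- Lebesgue measure on the unit interval. -/
noncomputable abbrev unitMeasure : Measure ℝ := volume.restrict (Ioo (0 : ℝ) 1)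

theorem ip_eq_integral (u v : ℝ → ℝ) : ip u v = ∫ x, u x * v x ∂unitMeasure := by
  rw [ip, intervalIntegral.integral_of_le zero_le_one, integral_Ioc_eq_integral_Ioo]

theorem avg_eq_integral (u : ℝ → ℝ) : avg u = ∫ x, u x ∂unitMeasure := by
  rw [avg, intervalIntegral.integral_of_le zero_le_one, integral_Ioc_eq_integral_Ioo]

theorem ip_congr {u u' v v' : ℝ → ℝ} (hu : u =ᵐ[unitMeasure] u') (hv : v =ᵐ[unitMeasure] v') :
    ip u v = ip u' v' := by
  rw [ip_eq_integral, ip_eq_integral]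
  exact integral_congr_ae (hu.mul hv)

theorem ip_comm (u v : ℝ → ℝ) : ip u v = ip v u := by
  simp [ip, mul_comm]

theorem MemL2.congr {u v : ℝ → ℝ} (hu : MemL2 u) (h : u =ᵐ[unitMeasure] v) : MemL2 v :=
  (memLp_congr_ae h).1 hu

theorem MemL2.add {u v : ℝ → ℝ} (hu : MemL2 u) (hv : MemL2 v) : MemL2 (u + v) :=
  MemLp.add hu hv

theorem MemL2.sub {u v : ℝ → ℝ} (hu : MemL2 u) (hv : MemL2 v) : MemL2 (u - v) :=
  MemLp.sub hu hv

theorem MemL2.const_mul {u : ℝ → ℝ} (hu : MemL2 u) (c : ℝ) : MemL2 (fun x => c * u x) :=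
  MemLp.const_mul hu c

theorem memL2_const (c : ℝ) : MemL2 (fun _ => c) := memLp_const c

theorem MemL2.integrable {u : ℝ → ℝ} (hu : MemL2 u) : Integrable u unitMeasure :=
  MemLp.integrable (by norm_num) hu

theorem intervalIntegrable_iff_unitMeasure {u : ℝ → ℝ} :
    IntervalIntegrable u volume 0 1 ↔ Integrable u unitMeasure := by
  rw [intervalIntegrable_iff_integrableOn_Ioo_of_le zero_le_one]; rfl

theorem MemL2.intervalIntegrable {u : ℝ → ℝ} (hu : MemL2 u) :
    IntervalIntegrable u volume 0 1 :=
  intervalIntegrable_iff_unitMeasure.2 hu.integrable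

theorem MemL2.integrable_mul {u v : ℝ → ℝ} (hu : MemL2 u) (hv : MemL2 v) :
    Integrable (fun x => u x * v x) unitMeasure :=
  MemLp.integrable_mul hu hv

theorem memL2_of_continuousOn {u : ℝ → ℝ} (hu : ContinuousOn u (Icc 0 1)) : MemL2 u := by
  obtain ⟨C, hC⟩ := isCompact_Icc.exists_bound_of_continuousOn hu
  refine MemLp.of_bound ((hu.mono Ioo_subset_Icc_self).aestronglyMeasurable measurableSet_Ioo) C ?_
  filter_upwards [ae_restrict_mem measurableSet_Ioo] with x hx using hC x (Ioo_subset_Icc_self hx)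

theorem ip_add_left {u v w : ℝ → ℝ} (hu : MemL2 u) (hv : MemL2 v) (hw : MemL2 w) :
    ip (u + v) w = ip u w + ip v w := by
  simp only [ip_eq_integral, Pi.add_apply, add_mul]
  exact integral_add (hu.integrable_mul hw) (hv.integrable_mul hw)

theorem ip_sub_left {u v w : ℝ → ℝ} (hu : MemL2 u) (hv : MemL2 v) (hw : MemL2 w) :
    ip (u - v) w = ip u w - ip v w := by
  simp only [ip_eq_integral, Pi.sub_apply, sub_mul]
  exact integral_sub (hu.integrable_mul hw) (hv.integrable_mul hw)

theorem ip_const_mul_left (c : ℝ) (u v : ℝ → ℝ) : ip (fun x => c * u x) v = c * ip u v := by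
  simp only [ip_eq_integral, mul_assoc]
  exact integral_const_mul c _

theorem ip_sub_right {u v w : ℝ → ℝ} (hu : MemL2 u) (hv : MemL2 v) (hw : MemL2 w) :
    ip w (u - v) = ip w u - ip w v := by
  rw [ip_comm, ip_sub_left hu hv hw, ip_comm u, ip_comm v]

theorem ip_add_right {u v w : ℝ → ℝ} (hu : MemL2 u) (hv : MemL2 v) (hw : MemL2 w) :
    ip w (u + v) = ip w u + ip w v := by
  rw [ip_comm, ip_add_left hu hv hw, ip_comm u, ip_comm v]

theorem ip_self_nonneg (u : ℝ → ℝ) : 0 ≤ ip u u := by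
  rw [ip_eq_integral]
  exact integral_nonneg fun x => mul_self_nonneg _

theorem l2Norm_nonneg (u : ℝ → ℝ) : 0 ≤ l2Norm u := Real.sqrt_nonneg _

theorem l2Norm_sq (u : ℝ → ℝ) : l2Norm u ^ 2 = ip u u := Real.sq_sqrt (ip_self_nonneg u)

theorem l2Norm_congr {u v : ℝ → ℝ} (h : u =ᵐ[unitMeasure] v) : l2Norm u = l2Norm v := by
  rw [l2Norm, l2Norm, ip_congr h h]

/-- The Cauchy-Schwarz inequality. -/
theorem abs_ip_le {u v : ℝ → ℝ} (hu : MemL2 u) (hv : MemL2 v) :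
    |ip u v| ≤ l2Norm u * l2Norm v := by
  -- ‖u - tv‖² ≥ 0 as a quadratic in t; its discriminant is therefore nonpositive.
  have key : ∀ t : ℝ, 0 ≤ ip v v * (t * t) + (-2 * ip u v) * t + ip u u := by
    intro t
    have h := ip_self_nonneg (u - fun x => t * v x)
    rw [ip_sub_left hu (hv.const_mul t) (hu.sub (hv.const_mul t)),
      ip_sub_right hu (hv.const_mul t) hu, ip_const_mul_left,
      ip_sub_right hu (hv.const_mul t) hv, ip_comm u (fun x => t * v x),
      ip_comm v (fun x => t * v x), ip_const_mul_left, ip_const_mul_left, ip_comm v u] at h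
    linarith
  have h := discrim_le_zero key
  rw [discrim] at h
  refine abs_le_of_sq_le_sq ?_ (mul_nonneg (l2Norm_nonneg u) (l2Norm_nonneg v))
  rw [mul_pow, l2Norm_sq, l2Norm_sq]
  linarith

/-! ### Test functions and the du Bois-Reymond lemma. -/

/-- A smooth function with compact support in `(0, 1)`. -/
def IsTest (φ : ℝ → ℝ) : Prop :=
  ContDiff ℝ ∞ φ ∧ HasCompactSupport φ ∧ tsupport φ ⊆ Ioo (0 : ℝ) 1

theorem integral_mul_eq_ip {φ : ℝ → ℝ} (hφ : tsupport φ ⊆ Ioo (0 : ℝ) 1) (g : ℝ → ℝ) :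
    ∫ x, φ x * g x = ip g φ := by
  rw [ip_comm, ip_eq_integral]
  refine (setIntegral_eq_integral_of_forall_compl_eq_zero fun x hx => ?_).symm
  rw [image_eq_zero_of_notMem_tsupport fun h => hx (hφ h), zero_mul]

theorem IsTest.memL2 {φ : ℝ → ℝ} (hφ : IsTest φ) : MemL2 φ :=
  memL2_of_continuousOn hφ.1.continuous.continuousOn

/-- The fundamental lemma of the calculus of variations on `(0, 1)`. -/
theorem ae_eq_zero_of_ip_test {g : ℝ → ℝ} (hg : Integrable g unitMeasure)
    (h : ∀ φ, IsTest φ → ip g φ = 0) : g =ᵐ[unitMeasure] 0 := by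
  refine (ae_restrict_iff' measurableSet_Ioo).2 ?_
  refine isOpen_Ioo.ae_eq_zero_of_integral_contDiff_smul_eq_zero
    (IntegrableOn.locallyIntegrableOn hg) fun φ h1 h2 h3 => ?_
  simpa only [smul_eq_mul, integral_mul_eq_ip h3] using h φ ⟨h1, h2, h3⟩

theorem exists_isTest_avg_eq_one : ∃ η, IsTest η ∧ avg η = 1 := by
  let f : ContDiffBump (1 / 2 : ℝ) := ⟨1 / 8, 1 / 4, by norm_num, by norm_num⟩
  have hs : tsupport (f.normed volume) ⊆ Ioo 0 1 := by
    rw [f.tsupport_normed_eq, Real.closedBall_eq_Icc]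
    intro x hx
    simp only [f, mem_Icc] at hx
    constructor <;> linarith [hx.1, hx.2]
  refine ⟨f.normed volume, ⟨f.contDiff_normed, f.hasCompactSupport_normed, hs⟩, ?_⟩
  have := integral_mul_eq_ip hs 1
  simpa [avg, ip, f.integral_normed] using this.symm

/-- A test function of mean zero is the derivative of a test function. -/
theorem exists_isTest_deriv_eq {θ : ℝ → ℝ} (hθ : IsTest θ) (h0 : avg θ = 0) :
    ∃ φ, IsTest φ ∧ deriv φ = θ := by
  -- Adding 1/2 keeps the compact set nonempty when θ = 0, so it has a least and a greatest element.
  have hK : IsCompact (insert (1 / 2) (tsupport θ)) := hθ.2.1.isCompact.insert _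
  have hKs : insert (1 / 2) (tsupport θ) ⊆ Ioo 0 1 :=
    insert_subset (by norm_num) hθ.2.2
  obtain ⟨a, ha, ha'⟩ := hK.exists_isLeast ⟨_, mem_insert _ _⟩
  obtain ⟨c, hc, hc'⟩ := hK.exists_isGreatest ⟨_, mem_insert _ _⟩
  have hz : ∀ x, x ∉ Icc a c → θ x = 0 := fun x hx =>
    image_eq_zero_of_notMem_tsupport fun h =>
      hx ⟨ha' (mem_insert_of_mem _ h), hc' (mem_insert_of_mem _ h)⟩
  have hcont := hθ.1.continuous
  let φ : ℝ → ℝ := fun x => ∫ t in (0 : ℝ)..x, θ t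
  have hd : ∀ x, HasDerivAt φ (θ x) x := fun x =>
    intervalIntegral.integral_hasDerivAt_right (hcont.intervalIntegrable _ _)
      (hcont.stronglyMeasurableAtFilter _ _) hcont.continuousAt
  have hderiv : deriv φ = θ := funext fun x => (hd x).deriv
  have hsupp : tsupport φ ⊆ Icc a c := by
    refine closure_minimal (fun x hx => ?_) isClosed_Icc
    by_contra hxac
    apply hx
    rcases lt_or_ge x a with hxa | hxa
    · refine (intervalIntegral.integral_congr (g := 0) fun t ht => hz t fun h => ?_).trans (by simp)
      have : t < a := by
        rcases mem_uIcc.1 ht with h | h <;> linarith [(hKs ha).1]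
      linarith [h.1]
    -- To the right of the support the primitive equals the whole integral of θ, which is zero.
    · have hxc : c < x := not_le.1 fun h => hxac ⟨hxa, h⟩
      have hs : ∀ y, c < y → Function.support θ ⊆ Ioc 0 y := fun y hy t ht => by
        have : t ∈ Icc a c := by_contra fun h => ht (hz t h)
        exact ⟨(hKs ha).1.trans_le this.1, this.2.trans hy.le⟩
      change ∫ t in (0 : ℝ)..x, θ t = 0
      rw [intervalIntegral.integral_eq_integral_of_support_subset (hs x hxc),
        ← intervalIntegral.integral_eq_integral_of_support_subset (hs 1 (hKs hc).2)]
      exact h0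
  refine ⟨φ, ⟨contDiff_infty_iff_deriv.2 ⟨fun x => (hd x).differentiableAt, hderiv ▸ hθ.1⟩,
    isCompact_Icc.of_isClosed_subset (isClosed_tsupport _) hsupp,
    hsupp.trans (Icc_subset_Ioo (hKs ha).1 (hKs hc).2)⟩, hderiv⟩

/-- The lemma of du Bois-Reymond. -/
theorem exists_eqOn_const_of_ip_deriv_test {w : ℝ → ℝ} (hw : ContinuousOn w (Icc 0 1))
    (h : ∀ φ, IsTest φ → ip w (deriv φ) = 0) : ∃ c, ∀ x ∈ Icc (0 : ℝ) 1, w x = c := by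
  obtain ⟨η, hη, hη1⟩ := exists_isTest_avg_eq_one
  have hwL := memL2_of_continuousOn hw
  have hc := memL2_const (ip w η)
  -- For a test function ψ, ψ - ψ̄η has mean zero and so is the derivative of a test function. Hence
  -- (w,ψ) = (w,η)ψ̄, which identifies the constant as (w,η).
  have hae : (w - fun _ => ip w η) =ᵐ[unitMeasure] 0 := by
    refine ae_eq_zero_of_ip_test (hwL.sub hc).integrable fun ψ hψ => ?_
    have hηψ := hη.memL2.const_mul (avg ψ)
    have hT : IsTest (ψ - fun x => avg ψ * η x) := by
      have h2 : tsupport (fun x => avg ψ * η x) ⊆ tsupport η :=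
        tsupport_mul_subset_right
      refine ⟨hψ.1.sub (contDiff_const.mul hη.1), hψ.2.1.sub hη.2.1.mul_left, ?_⟩
      exact (tsupport_sub _ _).trans (union_subset hψ.2.2 (h2.trans hη.2.2))
    have hmean : avg (ψ - fun x => avg ψ * η x) = 0 := by
      rw [avg_eq_integral]
      simp only [Pi.sub_apply]
      rw [integral_sub hψ.memL2.integrable hηψ.integrable, integral_const_mul,
        ← avg_eq_integral, ← avg_eq_integral, hη1, mul_one, sub_self]
    obtain ⟨φ, hφ, hφ'⟩ := exists_isTest_deriv_eq hT hmean
    have h1 := h φ hφ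
    rw [hφ', ip_sub_right hψ.memL2 hηψ hwL, ip_comm w (fun x => avg ψ * η x),
      ip_const_mul_left, ip_comm η w] at h1
    rw [ip_sub_left hwL hc hψ.memL2]
    have h3 : ip (fun _ => ip w η) ψ = ip w η * avg ψ :=
      intervalIntegral.integral_const_mul _ _
    rw [h3]; linarith
  refine ⟨ip w η, fun x hx => ?_⟩
  refine Measure.eqOn_Icc_of_ae_eq volume zero_ne_one (g := fun _ => ip w η) ?_ hw
    continuousOn_const hx
  rw [← restrict_Ioo_eq_restrict_Icc]
  filter_upwards [hae] with x hx using sub_eq_zero.1 hx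

/-! ### H¹₀ as a space of absolutely continuous functions. -/

theorem ae_unitMeasure_of_ae_uIcc {p : ℝ → Prop} (h : ∀ᵐ x, x ∈ uIcc (0 : ℝ) 1 → p x) :
    ∀ᵐ x ∂unitMeasure, p x := by
  refine (ae_restrict_iff' measurableSet_Ioo).2 ?_
  filter_upwards [h] with x hx hx'
  exact hx (by rw [uIcc_of_le zero_le_one]; exact Ioo_subset_Icc_self hx')

theorem deriv_ae_eq_of_eqOn {u v : ℝ → ℝ} (h : EqOn u v (Ioo 0 1)) :
    deriv u =ᵐ[unitMeasure] deriv v := by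
  filter_upwards [ae_restrict_mem measurableSet_Ioo] with x hx
  exact Filter.EventuallyEq.deriv_eq (Filter.eventuallyEq_of_mem (isOpen_Ioo.mem_nhds hx) h)

theorem absolutelyContinuous_congr {u v : ℝ → ℝ} (hu : AbsolutelyContinuousOnInterval u 0 1)
    (h : EqOn u v (Icc 0 1)) : AbsolutelyContinuousOnInterval v 0 1 := by
  rw [absolutelyContinuousOnInterval_iff] at hu ⊢
  intro e he
  obtain ⟨d, hd, H⟩ := hu e he
  refine ⟨d, hd, fun E hE hE' => ?_⟩
  have hE1 := hE.1
  rw [uIcc_of_le zero_le_one] at hE1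
  refine lt_of_eq_of_lt (Finset.sum_congr rfl fun i hi => ?_) (H E hE hE')
  rw [h (hE1 i hi).1, h (hE1 i hi).2]

theorem ip_deriv_right {u v : ℝ → ℝ} (hu : AbsolutelyContinuousOnInterval u 0 1)
    (hv : AbsolutelyContinuousOnInterval v 0 1) :
    ip u (deriv v) = u 1 * v 1 - u 0 * v 0 - ip (deriv u) v :=
  hu.integral_mul_deriv_eq_deriv_mul hv

theorem isWeakDeriv_deriv {u : ℝ → ℝ} (hu : AbsolutelyContinuousOnInterval u 0 1) :
    IsWeakDeriv u (deriv u) := by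
  intro φ h1 h2 h3
  have hφ : AbsolutelyContinuousOnInterval φ 0 1 :=
    ((h1.of_le (by exact_mod_cast le_top)).contDiffOn).absolutelyContinuousOnInterval
  rw [ip_deriv_right hu hφ,
    image_eq_zero_of_notMem_tsupport fun h => lt_irrefl _ (h3 h).1,
    image_eq_zero_of_notMem_tsupport fun h => lt_irrefl _ (h3 h).2]
  ring

/-- Makes the choice in `wderiv` immaterial under integrals. -/
theorem IsWeakDeriv.ae_eq {u g g' : ℝ → ℝ} (hg : MemL2 g) (hg' : MemL2 g')
    (h : IsWeakDeriv u g) (h' : IsWeakDeriv u g') : g =ᵐ[unitMeasure] g' := by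
  have : g - g' =ᵐ[unitMeasure] 0 := by
    refine ae_eq_zero_of_ip_test (hg.sub hg').integrable fun φ hφ => ?_
    rw [ip_sub_left hg hg' hφ.memL2]
    have h1 := h φ hφ.1 hφ.2.1 hφ.2.2
    have h2 := h' φ hφ.1 hφ.2.1 hφ.2.2
    linarith
  filter_upwards [this] with x hx using sub_eq_zero.1 hx

/-- The primitive of `F` vanishing at `0`. -/
noncomputable def primitive (F : ℝ → ℝ) (x : ℝ) : ℝ := ∫ t in (0 : ℝ)..x, F t

theorem MemL2.absolutelyContinuous_primitive {F : ℝ → ℝ} (hF : MemL2 F) :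
    AbsolutelyContinuousOnInterval (primitive F) 0 1 :=
  hF.intervalIntegrable.absolutelyContinuousOnInterval_intervalIntegral (by simp)

theorem MemL2.deriv_primitive {F : ℝ → ℝ} (hF : MemL2 F) :
    deriv (primitive F) =ᵐ[unitMeasure] F := by
  filter_upwards [ae_unitMeasure_of_ae_uIcc hF.intervalIntegrable.ae_hasDerivAt_integral] with x hx
  exact (hx 0 (by simp)).deriv

/-- Membership in `H¹₀(0,1)` in terms of absolute continuity and the pointwise derivative. -/
theorem mem_H10_iff {u : ℝ → ℝ} : u ∈ H10 ↔
    AbsolutelyContinuousOnInterval u 0 1 ∧ u 0 = 0 ∧ u 1 = 0 ∧ MemL2 (deriv u) := by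
  constructor
  · rintro ⟨hc, h0, h1, g, hg, hgu⟩
    have hG := hg.absolutelyContinuous_primitive
    have hGc : ContinuousOn (primitive g) (Icc 0 1) := by
      simpa only [uIcc_of_le (zero_le_one' ℝ)] using hG.continuousOn
    -- u and the primitive of its weak derivative have the same weak derivative, so they differ by a
    -- constant on [0,1].
    obtain ⟨c, hc'⟩ := exists_eqOn_const_of_ip_deriv_test (hc.sub hGc) fun φ hφ => by
      have hφ' : MemL2 (deriv φ) := memL2_of_continuousOn
        (hφ.1.continuous_deriv (by exact_mod_cast le_top)).continuousOn
      rw [ip_sub_left (memL2_of_continuousOn hc) (memL2_of_continuousOn hGc) hφ',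
        hgu φ hφ.1 hφ.2.1 hφ.2.2, isWeakDeriv_deriv hG φ hφ.1 hφ.2.1 hφ.2.2,
        ip_congr hg.deriv_primitive (Filter.EventuallyEq.refl _ φ), sub_self]
    have hG' : AbsolutelyContinuousOnInterval (primitive g + fun _ => c) 0 1 :=
      hG.add (LipschitzWith.const c).lipschitzOnWith.absolutelyContinuousOnInterval
    have heq : EqOn (primitive g + fun _ => c) u (Icc 0 1) := fun x hx => by
      have := hc' x hx
      simp only [Pi.add_apply, Pi.sub_apply] at this ⊢
      linarith
    refine ⟨absolutelyContinuous_congr hG' heq, h0, h1, hg.congr ?_⟩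
    refine hg.deriv_primitive.symm.trans (Filter.EventuallyEq.trans ?_
      (deriv_ae_eq_of_eqOn (heq.mono Ioo_subset_Icc_self)))
    filter_upwards with x
    exact (deriv_add_const (f := primitive g) c).symm
  · rintro ⟨hu, h0, h1, h⟩
    refine ⟨?_, h0, h1, _, h, isWeakDeriv_deriv hu⟩
    simpa only [uIcc_of_le (zero_le_one' ℝ)] using hu.continuousOn

theorem wderiv_ae_eq_deriv {u : ℝ → ℝ} (hu : u ∈ H10) : wderiv u =ᵐ[unitMeasure] deriv u := by
  obtain ⟨hac, -, -, hL⟩ := mem_H10_iff.1 hu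
  have h : ∃ g, MemL2 g ∧ IsWeakDeriv u g := ⟨_, hL, isWeakDeriv_deriv hac⟩
  rw [wderiv, dif_pos h]
  exact IsWeakDeriv.ae_eq h.choose_spec.1 hL h.choose_spec.2 (isWeakDeriv_deriv hac)

theorem memL2_of_mem_H10 {u : ℝ → ℝ} (hu : u ∈ H10) : MemL2 u := memL2_of_continuousOn hu.1

theorem memL2_deriv_of_mem_H10 {u : ℝ → ℝ} (hu : u ∈ H10) : MemL2 (deriv u) :=
  (mem_H10_iff.1 hu).2.2.2

theorem primitive_mem_H10 {F : ℝ → ℝ} (hF : MemL2 F) (h : avg F = 0) : primitive F ∈ H10 :=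
  mem_H10_iff.2 ⟨hF.absolutelyContinuous_primitive, intervalIntegral.integral_same, h,
    hF.congr hF.deriv_primitive.symm⟩

theorem deriv_sub_ae_eq {u v : ℝ → ℝ} (hu : u ∈ H10) (hv : v ∈ H10) :
    deriv (u - v) =ᵐ[unitMeasure] deriv u - deriv v := by
  filter_upwards [ae_unitMeasure_of_ae_uIcc (mem_H10_iff.1 hu).1.ae_differentiableAt,
    ae_unitMeasure_of_ae_uIcc (mem_H10_iff.1 hv).1.ae_differentiableAt] with x h1 h2
  exact deriv_sub h1 h2

theorem sub_mem_H10 {u v : ℝ → ℝ} (hu : u ∈ H10) (hv : v ∈ H10) : u - v ∈ H10 := by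
  have hu' := mem_H10_iff.1 hu
  have hv' := mem_H10_iff.1 hv
  refine mem_H10_iff.2 ⟨hu'.1.sub hv'.1, ?_, ?_, ?_⟩
  · simp [hu'.2.1, hv'.2.1]
  · simp [hu'.2.2.1, hv'.2.2.1]
  · exact (hu'.2.2.2.sub hv'.2.2.2).congr (deriv_sub_ae_eq hu hv).symm

theorem a0_eq {u v : ℝ → ℝ} (hu : u ∈ H10) (hv : v ∈ H10) : a0 u v = ip (deriv u) (deriv v) :=
  ip_congr (wderiv_ae_eq_deriv hu) (wderiv_ae_eq_deriv hv)

theorem h1Semi_eq {u : ℝ → ℝ} (hu : u ∈ H10) : h1Semi u = l2Norm (deriv u) :=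
  l2Norm_congr (wderiv_ae_eq_deriv hu)

theorem ip_deriv_eq_neg {u v : ℝ → ℝ} (hu : u ∈ H10) (hv : v ∈ H10) :
    ip (deriv u) v = -ip u (deriv v) := by
  have hu' := mem_H10_iff.1 hu
  rw [ip_deriv_right hu'.1 (mem_H10_iff.1 hv).1, hu'.2.1, hu'.2.2.1]
  ring

theorem avg_deriv {u : ℝ → ℝ} (hu : u ∈ H10) : avg (deriv u) = 0 := by
  have hu' := mem_H10_iff.1 hu
  rw [avg, hu'.1.integral_deriv_eq_sub, hu'.2.1, hu'.2.2.1, sub_self]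

theorem ip_const_left (c : ℝ) (u : ℝ → ℝ) : ip (fun _ => c) u = c * avg u :=
  intervalIntegral.integral_const_mul _ _

theorem avg_const_mul (c : ℝ) (u : ℝ → ℝ) : avg (fun x => c * u x) = c * avg u :=
  intervalIntegral.integral_const_mul _ _

theorem avg_const (c : ℝ) : avg (fun _ => c) = c := by simp [avg]

theorem avg_sub {u v : ℝ → ℝ} (hu : MemL2 u) (hv : MemL2 v) : avg (u - v) = avg u - avg v :=
  intervalIntegral.integral_sub hu.intervalIntegrable hv.intervalIntegrable

/-! ### The Riesz representative and the optimal norm. -/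

/-- The derivative `ε u' - (u - ū)` of the Riesz representative of `b(·, u)` in `H¹₀(0,1)`. -/
noncomputable def rieszDeriv (ε : ℝ) (u : ℝ → ℝ) : ℝ → ℝ :=
  (fun x => ε * deriv u x) - (u - fun _ => avg u)

theorem memL2_sub_avg {u : ℝ → ℝ} (hu : u ∈ H10) : MemL2 (u - fun _ => avg u) :=
  (memL2_of_mem_H10 hu).sub (memL2_const _)

theorem memL2_rieszDeriv (ε : ℝ) {u : ℝ → ℝ} (hu : u ∈ H10) : MemL2 (rieszDeriv ε u) :=
  ((memL2_deriv_of_mem_H10 hu).const_mul ε).sub (memL2_sub_avg hu)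

theorem avg_rieszDeriv (ε : ℝ) {u : ℝ → ℝ} (hu : u ∈ H10) : avg (rieszDeriv ε u) = 0 := by
  rw [rieszDeriv, avg_sub ((memL2_deriv_of_mem_H10 hu).const_mul ε) (memL2_sub_avg hu),
    avg_const_mul, avg_deriv hu, avg_sub (memL2_of_mem_H10 hu) (memL2_const _), avg_const]
  ring

theorem rieszDeriv_sub (ε : ℝ) {u v : ℝ → ℝ} (hu : u ∈ H10) (hv : v ∈ H10) :
    rieszDeriv ε (u - v) =ᵐ[unitMeasure] rieszDeriv ε u - rieszDeriv ε v := by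
  filter_upwards [deriv_sub_ae_eq hu hv] with x hx
  simp only [rieszDeriv, Pi.sub_apply, hx, avg_sub (memL2_of_mem_H10 hu) (memL2_of_mem_H10 hv)]
  ring

theorem b_eq_ip_rieszDeriv (ε : ℝ) {u v : ℝ → ℝ} (hu : u ∈ H10) (hv : v ∈ H10) :
    b ε v u = ip (rieszDeriv ε u) (deriv v) := by
  have hv' := memL2_deriv_of_mem_H10 hv
  rw [rieszDeriv, ip_sub_left ((memL2_deriv_of_mem_H10 hu).const_mul ε) (memL2_sub_avg hu) hv',
    ip_sub_left (memL2_of_mem_H10 hu) (memL2_const _) hv', ip_const_mul_left, ip_const_left,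
    avg_deriv hv, b, a0_eq hu hv, ip_congr (wderiv_ae_eq_deriv hu) (Filter.EventuallyEq.refl _ v),
    ip_deriv_eq_neg hu hv]
  ring

/-- The cross term vanishes: u' is orthogonal to constants, and (u',u) = -(u,u') forces (u',u) = 0.
-/
theorem ip_rieszDeriv_self (ε : ℝ) {u : ℝ → ℝ} (hu : u ∈ H10) :
    ip (rieszDeriv ε u) (rieszDeriv ε u)
      = ε ^ 2 * h1Semi u ^ 2 + l2Norm (fun x => u x - avg u) ^ 2 := by
  have h1 := (memL2_deriv_of_mem_H10 hu).const_mul ε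
  have h2 := memL2_sub_avg hu
  have h3 : ip (deriv u) (u - fun _ => avg u) = 0 := by
    have h := ip_deriv_eq_neg hu hu
    rw [ip_comm u] at h
    rw [ip_sub_right (memL2_of_mem_H10 hu) (memL2_const _) (memL2_deriv_of_mem_H10 hu),
      ip_comm _ (fun _ => avg u), ip_const_left, avg_deriv hu]
    linarith
  have h4 : ip (u - fun _ => avg u) (fun x => ε * deriv u x) = 0 := by
    rw [ip_comm, ip_const_mul_left, h3, mul_zero]
  change _ = _ + l2Norm (u - fun _ => avg u) ^ 2
  rw [h1Semi_eq hu, l2Norm_sq, l2Norm_sq, rieszDeriv, ip_sub_left h1 h2 (h1.sub h2),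
    ip_sub_right h1 h2 h1, ip_sub_right h1 h2 h2, h4, ip_const_mul_left, ip_const_mul_left, h3,
    ip_comm (deriv u), ip_const_mul_left]
  ring

theorem l2Norm_sub_avg_sq {u : ℝ → ℝ} (hu : MemL2 u) :
    l2Norm (fun x => u x - avg u) ^ 2 = l2Norm u ^ 2 - avg u ^ 2 := by
  have hc := memL2_const (avg u)
  change l2Norm (u - fun _ => avg u) ^ 2 = _
  rw [l2Norm_sq, l2Norm_sq, ip_sub_left hu hc (hu.sub hc), ip_const_left, avg_sub hu hc,
    avg_const, ip_sub_right hu hc hu, ip_comm u (fun _ => avg u), ip_const_left]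
  ring

/-- If the test space contains the Riesz representative of `b(·, u)`, the supremum of the
quotients `b(v, u) / |v|` is its norm. -/
theorem isLUB_quotients (ε : ℝ) {V : Set (ℝ → ℝ)} (hV : V ⊆ H10) {u : ℝ → ℝ} (hu : u ∈ H10)
    (hne : ∃ z ∈ V, h1Semi z ≠ 0) (hw : primitive (rieszDeriv ε u) ∈ V) :
    IsLUB (quotients ε V u) (l2Norm (rieszDeriv ε u)) := by
  have hF := memL2_rieszDeriv ε hu
  have hle : ∀ v ∈ V, |b ε v u| ≤ l2Norm (rieszDeriv ε u) * h1Semi v := fun v hv => by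
    rw [b_eq_ip_rieszDeriv ε hu (hV hv), h1Semi_eq (hV hv)]
    exact abs_ip_le hF (memL2_deriv_of_mem_H10 (hV hv))
  constructor
  · rintro r ⟨v, hv, hv0, rfl⟩
    have hpos : 0 < h1Semi v := (l2Norm_nonneg _).lt_of_ne' hv0
    exact (div_le_iff₀ hpos).2 ((le_abs_self _).trans (hle v hv))
  · intro c hc
    -- When F_u = 0 the representative has seminorm zero and yields no quotient; any admissible `z`
    -- then gives the quotient 0.
    by_cases h0 : l2Norm (rieszDeriv ε u) = 0
    · obtain ⟨z, hz, hz0⟩ := hne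
      have hb : b ε z u = 0 := by simpa [h0] using hle z hz
      rw [h0]
      exact hc ⟨z, hz, hz0, by rw [hb, zero_div]⟩
    · have hn : h1Semi (primitive (rieszDeriv ε u)) = l2Norm (rieszDeriv ε u) := by
        rw [h1Semi_eq (hV hw), l2Norm_congr hF.deriv_primitive]
      refine hc ⟨_, hw, by rwa [hn], ?_⟩
      rw [b_eq_ip_rieszDeriv ε hu (hV hw), hn,
        ip_congr (Filter.EventuallyEq.refl _ (rieszDeriv ε u)) hF.deriv_primitive, ← l2Norm_sq, sq,
        mul_div_cancel_right₀ _ h0]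

/-! ### Finite element spaces and the discrete norm. -/

theorem feSpace_subset_H10 (k n : ℕ) : feSpace k n ⊆ H10 := fun _ h => h.1

theorem sub_mem_feSpace {k n : ℕ} {u v : ℝ → ℝ} (hu : u ∈ feSpace k n) (hv : v ∈ feSpace k n) :
    u - v ∈ feSpace k n := by
  refine ⟨sub_mem_H10 hu.1 hv.1, fun j hj => ?_⟩
  obtain ⟨p, hp, hpu⟩ := hu.2 j hj
  obtain ⟨q, hq, hqv⟩ := hv.2 j hj
  refine ⟨p - q, Polynomial.natDegree_sub_le_of_le hp hq |>.trans (by simp), fun x hx => ?_⟩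
  rw [Pi.sub_apply, hpu x hx, hqv x hx, Polynomial.eval_sub]

theorem element_subset_Icc {n j : ℕ} (hj : j < n) :
    Icc ((j : ℝ) / n) (((j : ℝ) + 1) / n) ⊆ Icc 0 1 := by
  have hn : (0 : ℝ) < n := by exact_mod_cast (Nat.zero_le j).trans_lt hj
  have hj' : (j : ℝ) + 1 ≤ n := by exact_mod_cast hj
  exact Icc_subset_Icc (by positivity) ((div_le_one hn).2 hj')

/-- The Riesz representative of `b(·, u)` for a piecewise linear `u` is piecewise quadratic. -/
theorem primitive_rieszDeriv_mem_testSpace (ε : ℝ) {n : ℕ} {u : ℝ → ℝ} (hu : u ∈ trialSpace n) :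
    primitive (rieszDeriv ε u) ∈ testSpace n := by
  have hF := memL2_rieszDeriv ε hu.1
  refine ⟨primitive_mem_H10 hF (avg_rieszDeriv ε hu.1), fun j hj => ?_⟩
  obtain ⟨p, hp, hpu⟩ := hu.2 j hj
  obtain ⟨c, d, rfl⟩ := Polynomial.exists_eq_X_add_C_of_natDegree_le_one hp
  simp only [Polynomial.eval_add, Polynomial.eval_mul, Polynomial.eval_C,
    Polynomial.eval_X] at hpu
  have hsub := element_subset_Icc hj
  set y : ℝ := (j : ℝ) / n
  set z : ℝ := ((j : ℝ) + 1) / n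
  -- Inside the element u = ct + d, so F_u = m - ct; integrating from the left node y gives the
  -- quadratic below.
  set m : ℝ := ε * c - d + avg u
  refine ⟨Polynomial.C (-(c / 2)) * Polynomial.X ^ 2 + Polynomial.C m * Polynomial.X
    + Polynomial.C (primitive (rieszDeriv ε u) y + c / 2 * y ^ 2 - m * y),
    Polynomial.natDegree_quadratic_le, fun x hx => ?_⟩
  have hy : y ∈ Icc 0 1 := hsub ⟨le_rfl, hx.1.trans hx.2⟩
  have hx1 : x ∈ Icc 0 1 := hsub hx
  have hval : ∀ t ∈ Ioo y x, rieszDeriv ε u t = m - c * t := fun t ht => by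
    have hderiv : HasDerivAt u c t := by
      have h1 : HasDerivAt (fun t : ℝ => c * t + d) c t := by
        simpa using ((hasDerivAt_id t).const_mul c).add_const d
      refine h1.congr_of_eventuallyEq (Filter.eventuallyEq_of_mem (isOpen_Ioo.mem_nhds ht) ?_)
      exact fun s hs => hpu s ⟨hs.1.le, hs.2.le.trans hx.2⟩
    simp only [rieszDeriv, Pi.sub_apply, hderiv.deriv,
      hpu t ⟨ht.1.le, ht.2.le.trans hx.2⟩, m]
    ring
  have hint : ∫ t in y..x, rieszDeriv ε u t = m * (x - y) - c * ((x ^ 2 - y ^ 2) / 2) := by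
    have h : ∫ t in y..x, rieszDeriv ε u t = ∫ t in y..x, (m - c * t) := by
      rw [intervalIntegral.integral_of_le hx.1, intervalIntegral.integral_of_le hx.1,
        integral_Ioc_eq_integral_Ioo, integral_Ioc_eq_integral_Ioo]
      exact setIntegral_congr_fun measurableSet_Ioo hval
    rw [h, intervalIntegral.integral_sub (f := fun _ => m) (g := fun t => c * t)
      (continuous_const.intervalIntegrable _ _)
      (Continuous.intervalIntegrable (by fun_prop) _ _),
      intervalIntegral.integral_const_mul, integral_id, intervalIntegral.integral_const,
      smul_eq_mul, mul_comm (x - y)]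
  have hmono : ∀ {s t : ℝ}, s ∈ Icc (0 : ℝ) 1 → t ∈ Icc (0 : ℝ) 1 →
      IntervalIntegrable (rieszDeriv ε u) volume s t := fun hs ht =>
    hF.intervalIntegrable.mono_set (by
      rw [uIcc_of_le zero_le_one]; exact uIcc_subset_Icc hs ht)
  have hadd := intervalIntegral.integral_add_adjacent_intervals
    (hmono (left_mem_Icc.2 zero_le_one) hy) (hmono hy hx1)
  simp only [Polynomial.eval_add, Polynomial.eval_mul, Polynomial.eval_C, Polynomial.eval_X,
    Polynomial.eval_pow]
  rw [hint] at hadd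
  change primitive (rieszDeriv ε u) y + _ = primitive (rieszDeriv ε u) x at hadd
  rw [← hadd]
  ring

/-- A single global quadratic, available on every mesh, witnesses that the quotients are not
vacuous. -/
theorem bubble_mem_testSpace (n : ℕ) : (fun x : ℝ => x * (1 - x)) ∈ testSpace n := by
  have hd : deriv (fun x : ℝ => x * (1 - x)) = fun x => 1 - 2 * x := by
    ext x
    have h := (hasDerivAt_id x).mul ((hasDerivAt_id x).const_sub 1)
    refine (h.congr_deriv ?_).deriv
    simp only [id]; ring
  refine ⟨mem_H10_iff.2 ⟨ContDiffOn.absolutelyContinuousOnInterval ?_, by simp, by simp, ?_⟩,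
    fun j _ => ⟨Polynomial.C (-1) * Polynomial.X ^ 2 + Polynomial.C 1 * Polynomial.X
      + Polynomial.C 0, Polynomial.natDegree_quadratic_le, fun x _ => ?_⟩⟩
  · exact (contDiff_id.mul (contDiff_const.sub contDiff_id)).contDiffOn
  · rw [hd]
    exact memL2_of_continuousOn (by fun_prop)
  · simp; ring

theorem eq_zero_of_h1Semi_eq_zero {u : ℝ → ℝ} (hu : u ∈ H10) (h : h1Semi u = 0) :
    ∀ x ∈ Icc (0 : ℝ) 1, u x = 0 := by
  have hu' := mem_H10_iff.1 hu
  rw [h1Semi_eq hu, l2Norm, Real.sqrt_eq_zero (ip_self_nonneg _), ip_eq_integral,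
    integral_eq_zero_iff_of_nonneg (fun x => mul_self_nonneg _)
      (hu'.2.2.2.integrable_mul hu'.2.2.2)] at h
  have hd : deriv u =ᵐ[unitMeasure] 0 := by
    filter_upwards [h] with x hx using mul_self_eq_zero.1 hx
  obtain ⟨c, hc⟩ := exists_eqOn_const_of_ip_deriv_test hu.1 fun φ hφ => by
    rw [isWeakDeriv_deriv hu'.1 φ hφ.1 hφ.2.1 hφ.2.2,
      ip_congr hd (Filter.EventuallyEq.refl _ φ)]
    simp [ip]
  intro x hx
  rw [hc x hx, ← hc 0 (by simp), hu'.2.1]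

theorem exists_mem_testSpace_h1Semi_ne_zero (n : ℕ) : ∃ z ∈ testSpace n, h1Semi z ≠ 0 := by
  refine ⟨_, bubble_mem_testSpace n, fun h => ?_⟩
  have := eq_zero_of_h1Semi_eq_zero (bubble_mem_testSpace n).1 h (1 / 2) (by norm_num)
  norm_num at this

theorem isLUB_quotients_H10 (ε : ℝ) {u : ℝ → ℝ} (hu : u ∈ H10) :
    IsLUB (quotients ε H10 u) (l2Norm (rieszDeriv ε u)) := by
  obtain ⟨z, hz, hz0⟩ := exists_mem_testSpace_h1Semi_ne_zero 1
  exact isLUB_quotients ε subset_rfl hu ⟨z, hz.1, hz0⟩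
    (primitive_mem_H10 (memL2_rieszDeriv ε hu) (avg_rieszDeriv ε hu))

theorem quotients_H10_nonempty (ε : ℝ) (u : ℝ → ℝ) : (quotients ε H10 u).Nonempty := by
  obtain ⟨z, hz, hz0⟩ := exists_mem_testSpace_h1Semi_ne_zero 1
  exact ⟨_, z, hz.1, hz0, rfl⟩

theorem starNorm_eq (ε : ℝ) {u : ℝ → ℝ} (hu : u ∈ H10) :
    starNorm ε u = l2Norm (rieszDeriv ε u) :=
  (isLUB_quotients_H10 ε hu).csSup_eq (quotients_H10_nonempty ε u)

theorem isLUB_quotients_testSpace (ε : ℝ) {n : ℕ} {u : ℝ → ℝ} (hu : u ∈ trialSpace n) :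
    IsLUB (quotients ε (testSpace n) u) (l2Norm (rieszDeriv ε u)) :=
  isLUB_quotients ε (feSpace_subset_H10 2 n) hu.1 (exists_mem_testSpace_h1Semi_ne_zero n)
    (primitive_rieszDeriv_mem_testSpace ε hu)

theorem starNormDiscrete_eq (ε : ℝ) {n : ℕ} {u : ℝ → ℝ} (hu : u ∈ trialSpace n) :
    starNormDiscrete ε n u = l2Norm (rieszDeriv ε u) := by
  obtain ⟨z, hz, hz0⟩ := exists_mem_testSpace_h1Semi_ne_zero n
  exact (isLUB_quotients_testSpace ε hu).csSup_eq ⟨_, z, hz, hz0, rfl⟩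

/-! ### The nodal interpolant lies in the trial space. -/

theorem abs_hat_sub_le (n j : ℕ) (x y : ℝ) : |hat n j x - hat n j y| ≤ n * |x - y| := by
  have h1 : |hat n j x - hat n j y| ≤ |(1 - |n * x - j|) - (1 - |n * y - j|)| := by
    have := abs_max_sub_max_le_max (0 : ℝ) (1 - |n * x - j|) 0 (1 - |n * y - j|)
    simpa [hat] using this
  have h2 := abs_abs_sub_abs_le (n * y - j : ℝ) (n * x - j)
  have h3 : |(n * y - j : ℝ) - (n * x - j)| = n * |x - y| := by
    rw [show (n * y - j : ℝ) - (n * x - j) = n * (y - x) by ring, abs_mul, Nat.abs_cast,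
      abs_sub_comm]
  rw [show (1 - |n * x - j|) - (1 - |n * y - j|) = |(n * y - j : ℝ)| - |(n * x - j : ℝ)| by ring]
    at h1
  linarith

theorem exists_lipschitzWith_nodalInterp (n : ℕ) (u : ℝ → ℝ) :
    ∃ K, LipschitzWith K (nodalInterp n u) := by
  refine ⟨∑ j ∈ Finset.range (n + 1), ‖u ((j : ℝ) / n)‖₊ * n,
    LipschitzWith.of_dist_le_mul fun x y => ?_⟩
  rw [Real.dist_eq, Real.dist_eq, nodalInterp, nodalInterp, ← Finset.sum_sub_distrib]
  push_cast
  rw [Finset.sum_mul]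
  refine (Finset.abs_sum_le_sum_abs _ _).trans (Finset.sum_le_sum fun j _ => ?_)
  rw [← mul_sub, abs_mul, mul_assoc, Real.norm_eq_abs]
  exact mul_le_mul_of_nonneg_left (abs_hat_sub_le n j x y) (abs_nonneg _)

/-- A Lipschitz function is absolutely continuous with bounded derivative, so the kinks of the
interpolant need no separate treatment. -/
theorem mem_H10_of_lipschitzWith {u : ℝ → ℝ} {K : NNReal} (hu : LipschitzWith K u) (h0 : u 0 = 0)
    (h1 : u 1 = 0) : u ∈ H10 :=
  mem_H10_iff.2 ⟨hu.lipschitzOnWith.absolutelyContinuousOnInterval, h0, h1,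
    MemLp.of_bound (measurable_deriv u).aestronglyMeasurable K
      (Filter.Eventually.of_forall fun _ => norm_deriv_le_of_lipschitz hu)⟩

theorem hat_natCast_eq_zero {n i j : ℕ} (hij : i ≠ j) {x : ℝ} (hx : n * x = i) :
    hat n j x = 0 := by
  refine max_eq_left (sub_nonpos.2 ?_)
  rw [hx]
  have : (1 : ℤ) ≤ |(i : ℤ) - j| := Int.one_le_abs (sub_ne_zero.2 (by exact_mod_cast hij))
  exact_mod_cast this

theorem exists_polynomial_hat {n i j : ℕ} (hj : j < n) :
    ∃ p : Polynomial ℝ, p.natDegree ≤ 1 ∧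
      ∀ x ∈ Icc ((j : ℝ) / n) (((j : ℝ) + 1) / n), hat n i x = p.eval x := by
  have hn : (0 : ℝ) < n := by exact_mod_cast (Nat.zero_le j).trans_lt hj
  have hb : ∀ x ∈ Icc ((j : ℝ) / n) (((j : ℝ) + 1) / n), (j : ℝ) ≤ n * x ∧ n * x ≤ j + 1 :=
    fun x hx => ⟨(div_le_iff₀' hn).1 hx.1, (le_div_iff₀' hn).1 hx.2⟩
  rcases lt_trichotomy i j with h | rfl | h
  -- The hat falls on the element starting at its node (i = j), rises on the one ending there (i = j
  -- + 1), and vanishes on all others.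
  · have h' : (i : ℝ) + 1 ≤ j := by exact_mod_cast h
    refine ⟨0, by simp, fun x hx => ?_⟩
    rw [Polynomial.eval_zero]
    refine max_eq_left (sub_nonpos.2 ?_)
    rw [abs_of_nonneg] <;> linarith [hb x hx]
  · refine ⟨Polynomial.C (-(n : ℝ)) * Polynomial.X + Polynomial.C (1 + i : ℝ),
      Polynomial.natDegree_linear_le, fun x hx => ?_⟩
    have := hb x hx
    rw [hat, abs_of_nonneg (by linarith), max_eq_right (by linarith)]
    simp; ring
  · rcases Nat.eq_or_lt_of_le (Nat.succ_le_of_lt h) with rfl | h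
    · refine ⟨Polynomial.C (n : ℝ) * Polynomial.X + Polynomial.C (-j : ℝ),
        Polynomial.natDegree_linear_le, fun x hx => ?_⟩
      have := hb x hx
      rw [hat, Nat.cast_succ, abs_of_nonpos (by linarith), max_eq_right (by linarith)]
      simp; ring
    · have h' : (j : ℝ) + 1 + 1 ≤ i := by exact_mod_cast h
      refine ⟨0, by simp, fun x hx => ?_⟩
      rw [Polynomial.eval_zero]
      refine max_eq_left (sub_nonpos.2 ?_)
      rw [abs_of_nonpos] <;> linarith [hb x hx]

theorem nodalInterp_mem_trialSpace {n : ℕ} (hn : 1 ≤ n) {u : ℝ → ℝ} (h0 : u 0 = 0) (h1 : u 1 = 0) :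
    nodalInterp n u ∈ trialSpace n := by
  obtain ⟨K, hK⟩ := exists_lipschitzWith_nodalInterp n u
  refine ⟨mem_H10_of_lipschitzWith hK ?_ ?_, fun j hj => ?_⟩
  · refine Finset.sum_eq_zero fun j _ => ?_
    rcases eq_or_ne 0 j with rfl | hj
    · simp [h0]
    · rw [hat_natCast_eq_zero hj (by simp), mul_zero]
  · refine Finset.sum_eq_zero fun j _ => ?_
    rcases eq_or_ne n j with rfl | hj
    · rw [div_self (by positivity), h1, zero_mul]
    · rw [hat_natCast_eq_zero hj (by simp), mul_zero]
  · choose p hp hpe using fun i : ℕ => exists_polynomial_hat (i := i) hj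
    refine ⟨∑ i ∈ Finset.range (n + 1), Polynomial.C (u ((i : ℝ) / n)) * p i,
      Polynomial.natDegree_sum_le_of_forall_le _ _ fun i _ =>
        (Polynomial.natDegree_C_mul_le _ _).trans (hp i), fun x hx => ?_⟩
    simp only [nodalInterp, Polynomial.eval_finsetSum, Polynomial.eval_mul, Polynomial.eval_C]
    exact Finset.sum_congr rfl fun i _ => by rw [hpe i x hx]

/-! ### Orthogonality of the error and best approximation. -/

/-- Galerkin orthogonality of the SPLS error. -/
theorem ip_rieszDeriv_error_eq_zero {ε : ℝ} {n : ℕ} {f u wh uh q : ℝ → ℝ}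
    (hu : IsWeakSolution ε f u) (h : IsSPLSSolution ε n f wh uh) (hq : q ∈ trialSpace n) :
    ip (rieszDeriv ε (u - uh)) (rieszDeriv ε q) = 0 := by
  obtain ⟨hw, huh, h1, h2⟩ := h
  -- This `v` has v' = F_q almost everywhere, so a₀(w_h,v) = (w_h',F_q) = b(w_h,q) = 0.
  have hv := primitive_rieszDeriv_mem_testSpace ε hq
  have hqL := memL2_rieszDeriv ε hq.1
  have hrefl (g : ℝ → ℝ) : g =ᵐ[unitMeasure] g := Filter.EventuallyEq.refl _ g
  have e1 := hu.2 _ hv.1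
  have e2 := h1 _ hv
  have e3 := h2 q hq
  rw [b_eq_ip_rieszDeriv ε hu.1 hv.1, ip_congr (hrefl _) hqL.deriv_primitive] at e1
  rw [b_eq_ip_rieszDeriv ε huh.1 hv.1, ip_congr (hrefl _) hqL.deriv_primitive,
    a0_eq hw.1 hv.1, ip_congr (hrefl _) hqL.deriv_primitive] at e2
  rw [b_eq_ip_rieszDeriv ε hq.1 hw.1, ip_comm] at e3
  rw [ip_congr (rieszDeriv_sub ε hu.1 huh.1) (hrefl _),
    ip_sub_left (memL2_rieszDeriv ε hu.1) (memL2_rieszDeriv ε huh.1) hqL]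
  linarith

/-- The SPLS solution is the best approximation in the optimal trial norm. -/
theorem starNorm_error_le {ε : ℝ} {n : ℕ} {f u wh uh p : ℝ → ℝ}
    (hu : IsWeakSolution ε f u) (h : IsSPLSSolution ε n f wh uh) (hp : p ∈ trialSpace n) :
    starNorm ε (u - uh) ≤ starNorm ε (u - p) := by
  have huh := h.2.1
  have hq := sub_mem_feSpace huh hp
  have he := sub_mem_H10 hu.1 huh.1
  have heL := memL2_rieszDeriv ε he
  have hqL := memL2_rieszDeriv ε hq.1
  have hsplit : rieszDeriv ε (u - p) =ᵐ[unitMeasure]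
      rieszDeriv ε (u - uh) + rieszDeriv ε (uh - p) := by
    filter_upwards [rieszDeriv_sub ε hu.1 huh.1, rieszDeriv_sub ε huh.1 hp.1,
      rieszDeriv_sub ε hu.1 hp.1] with x a1 a2 a3
    simp only [Pi.add_apply, Pi.sub_apply, a1, a2, a3]
    ring
  have horth := ip_rieszDeriv_error_eq_zero hu h hq
  rw [starNorm_eq ε he, starNorm_eq ε (sub_mem_H10 hu.1 hp.1), l2Norm_congr hsplit]
  refine Real.sqrt_le_sqrt ?_
  rw [ip_add_left heL hqL (heL.add hqL), ip_add_right heL hqL heL, ip_add_right heL hqL hqL,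
    ip_comm (rieszDeriv ε (uh - p)), horth]
  linarith [ip_self_nonneg (rieszDeriv ε (uh - p))]

end SPLS

theorem theorem3p2 (ε : ℝ) (hε : 0 < ε) (n : ℕ) (hn : 1 ≤ n) :
    -- the continuous optimal trial norm: the supremum is finite and has the stated value
    (∀ u ∈ SPLS.H10,
      IsLUB (SPLS.quotients ε SPLS.H10 u) (SPLS.starNorm ε u) ∧
      SPLS.starNorm ε u ^ 2
        = ε ^ 2 * SPLS.h1Semi u ^ 2 + SPLS.l2Norm (fun x => u x - SPLS.avg u) ^ 2 ∧
      SPLS.starNorm ε u ^ 2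
        = ε ^ 2 * SPLS.h1Semi u ^ 2 + SPLS.l2Norm u ^ 2 - SPLS.avg u ^ 2) ∧
    -- the discrete optimal trial norm coincides with it on the trial space
    (∀ u ∈ SPLS.trialSpace n,
      IsLUB (SPLS.quotients ε (SPLS.testSpace n) u) (SPLS.starNormDiscrete ε n u) ∧
      SPLS.starNormDiscrete ε n u = SPLS.starNorm ε u) ∧
    -- the error estimate
    (∀ f u wh uh : ℝ → ℝ, SPLS.MemL2 f → SPLS.IsWeakSolution ε f u →
      SPLS.IsSPLSSolution ε n f wh uh →
      SPLS.starNorm ε (u - uh) ≤ (⨅ p : SPLS.trialSpace n, SPLS.starNorm ε (u - p)) ∧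
      SPLS.nodalInterp n u ∈ SPLS.trialSpace n ∧
      (⨅ p : SPLS.trialSpace n, SPLS.starNorm ε (u - p))
        ≤ SPLS.starNorm ε (u - SPLS.nodalInterp n u)) := by
  refine ⟨fun u hu => ?_, fun u hu => ?_, fun f u wh uh _ hu h => ?_⟩
  · have hsq : SPLS.starNorm ε u ^ 2
        = ε ^ 2 * SPLS.h1Semi u ^ 2 + SPLS.l2Norm (fun x => u x - SPLS.avg u) ^ 2 := by
      rw [SPLS.starNorm_eq ε hu, SPLS.l2Norm_sq, SPLS.ip_rieszDeriv_self ε hu]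
    refine ⟨SPLS.starNorm_eq ε hu ▸ SPLS.isLUB_quotients_H10 ε hu, hsq, ?_⟩
    rw [hsq, SPLS.l2Norm_sub_avg_sq (SPLS.memL2_of_mem_H10 hu)]
    ring
  · rw [SPLS.starNorm_eq ε hu.1, SPLS.starNormDiscrete_eq ε hu]
    exact ⟨SPLS.isLUB_quotients_testSpace ε hu, rfl⟩
  · have hI := SPLS.nodalInterp_mem_trialSpace hn hu.1.2.1 hu.1.2.2.1
    have : Nonempty (SPLS.trialSpace n) := ⟨⟨_, hI⟩⟩
    refine ⟨le_ciInf fun p => SPLS.starNorm_error_le hu h p.2, hI, ?_⟩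
    -- A real infimum needs a lower bound for the family; the best approximation property supplies
    -- the error of u_h.
    refine ciInf_le (f := fun p : SPLS.trialSpace n => SPLS.starNorm ε (u - p))
      ⟨SPLS.starNorm ε (u - uh), ?_⟩ ⟨_, hI⟩
    rintro _ ⟨p, rfl⟩
    exact SPLS.starNorm_error_le hu h p.2
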